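/- A \emph{spinal path} is a path $v_1,\dots,v_n$ with a fixed order of its vertices (the path through the points on the spine of a monotone topological book embedding, in spine order; every ordered path arises in this way). Spinal paths $P_1,\dots,P_k$, each with $n$ vertices colored from a common palette, are \emph{compatibly colored} if for every color $q$ all of them have the same number of vertices of color $q$. A \emph{simultaneous drawing} of such paths consists of a planar polyline drawing of each path in $\mathbb{R}^2$ such that for every color $q$ the set of locations of the vertices of color $q$ is the same in all $k$ drawings. A planar polyline drawing of $v_1,\dots,v_n$ is \emph{uphill} if for every point $r$ of the drawing, the open upward vertical ray from $r$ does not intersect the part of the drawing that leads from $v_1$ to $r$. \textbf{Lemma.} There is an absolute constant $C$ such that the following holds for all $k$, $n$ and all $0\le\alpha\le 1$ for which $n^\alpha$ is an integer. Every $k$ spinal paths, each with $n$ vertices, that are compatibly colored with a palette of $n^\alpha$ colors, have a simultaneous drawing in which each path is drawn uphill with at most $$C\cdot\min\{n^\alpha,\ n^{1-(1/2)^k}\}$$ bends on each edge. -/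

import Mathlib

namespace SimEmbed

/-- A polyline in the plane with corner points `pt 0, pt 1, …, pt (bends + 1)`: the first and the
last are its end points, the `bends` points in between are its bends.
(The values of `pt` beyond `bends + 1` are irrelevant.) -/
structure Polyline where
  bends : ℕ
  pt : ℕ → ℝ × ℝ

namespace Polyline

/-- The parameter interval `[0, bends + 1]`; the `j`-th segment is traversed on `[j, j + 1]`. -/
def dom (P : Polyline) : Set ℝ := Set.Icc 0 ((P.bends : ℝ) + 1)

/-- The parametrization of the polyline, affine on every `[j, j + 1]`, with value `pt j` at `j`. -/
noncomputable def eval (P : Polyline) (t : ℝ) : ℝ × ℝ :=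
  AffineMap.lineMap (P.pt ⌊t⌋₊) (P.pt (⌊t⌋₊ + 1)) (t - (⌊t⌋₊ : ℝ))

/-- The set of all points of the polyline. -/
def carrier (P : Polyline) : Set (ℝ × ℝ) := P.eval '' P.dom

/-- The polyline does not meet itself. -/
def IsSimple (P : Polyline) : Prop := Set.InjOn P.eval P.dom

end Polyline

/-- A spinal path with `n` vertices, colored with (at most) `c` colors. As a combinatorial object,
a spinal path is the path `v 0, v 1, …, v (n - 1)` through the points of the spine of a monotone
topological book embedding, in their order on the spine. Every colored vertex sequence arises so
(place a path graph along the spine), hence the data are exactly the colors of the vertices in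
order. Its edges are the `n - 1` pairs `{v e, v (e + 1)}`, indexed by `e : Fin (n - 1)`. -/
structure SpinalPath (n c : ℕ) where
  color : Fin n → Fin c

/-- For every color, all the paths have the same number of vertices of that color. -/
def CompatiblyColored {k n c : ℕ} (Q : Fin k → SpinalPath n c) : Prop :=
  ∀ (q : Fin c) (i j : Fin k),
    {v : Fin n | (Q i).color v = q}.ncard = {v : Fin n | (Q j).color v = q}.ncard

/-- The first end vertex of the edge `e` of the path with `n` vertices. -/
def edgeFst {n : ℕ} (e : Fin (n - 1)) : Fin n := ⟨e.1, by omega⟩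

/-- The second end vertex of the edge `e` of the path with `n` vertices. -/
def edgeSnd {n : ℕ} (e : Fin (n - 1)) : Fin n := ⟨e.1 + 1, by omega⟩

/-- The vertex `v` is an end vertex of the edge `e`. -/
def Incident {n : ℕ} (v : Fin n) (e : Fin (n - 1)) : Prop := v = edgeFst e ∨ v = edgeSnd e

/-- A polyline drawing of the path with `n` vertices: a location for every vertex and, for every
edge, a polyline from the location of its first to the location of its second end vertex. -/
structure PathDrawing (n : ℕ) where
  loc : Fin n → ℝ × ℝ
  edge : Fin (n - 1) → Polyline
  edge_source : ∀ e, (edge e).pt 0 = loc (edgeFst e)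
  edge_target : ∀ e, (edge e).pt ((edge e).bends + 1) = loc (edgeSnd e)

namespace PathDrawing

variable {n : ℕ}

/-- The drawing is planar: distinct vertices have distinct locations, every edge is a simple
polyline, an edge passes through the locations of its own end vertices only, and two different
edges meet only in the location of a common end vertex. -/
structure IsPlanar (D : PathDrawing n) : Prop where
  loc_injective : Function.Injective D.loc
  edge_simple : ∀ e, (D.edge e).IsSimple
  incident_of_mem : ∀ v e, D.loc v ∈ (D.edge e).carrier → Incident v e
  edge_inter : ∀ e e', e ≠ e' → ∀ p ∈ (D.edge e).carrier ∩ (D.edge e').carrier,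
    ∃ v, Incident v e ∧ Incident v e' ∧ p = D.loc v

/-- The part of the drawing from the first vertex up to the point with parameter `t` on the
edge `e`. -/
def upTo (D : PathDrawing n) (e : Fin (n - 1)) (t : ℝ) : Set (ℝ × ℝ) :=
  (⋃ e' ∈ Set.Iio e, (D.edge e').carrier) ∪ (D.edge e).eval '' Set.Icc 0 t

/-- The upward vertical ray from `r`, without `r` itself. -/
def upwardRay (r : ℝ × ℝ) : Set (ℝ × ℝ) := {p | p.1 = r.1 ∧ r.2 < p.2}

/-- The drawing is uphill: for every point `r` of it, the upward ray from `r` does not meet the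
part of the drawing that leads from the first vertex to `r`. (Every vertex is an end point of an
edge, unless the path has a single vertex, and then there is nothing to require.) -/
def IsUphill (D : PathDrawing n) : Prop :=
  ∀ e, ∀ t ∈ (D.edge e).dom, Disjoint (upwardRay ((D.edge e).eval t)) (D.upTo e t)

end PathDrawing

/-- The drawings `D i` of the colored paths `Q i` form a simultaneous drawing: each one is planar,
and for every color, the set of locations of the vertices of that color is the same in all the
drawings. -/
structure IsSimultaneousDrawing {k n c : ℕ} (Q : Fin k → SpinalPath n c)
    (D : Fin k → PathDrawing n) : Prop where
  planar : ∀ i, (D i).IsPlanar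
  same_locations : ∀ (q : Fin c) (i j : Fin k),
    (D i).loc '' {v | (Q i).color v = q} = (D j).loc '' {v | (Q j).color v = q}

end SimEmbed

/-! All drawings use the points `(j, 0)`, and a permutation `τ` tells at which time the path visits
position `j`. Edge `e` follows a piecewise affine graph that passes above the vertices visited
earlier, through its two ends, and below those visited later. The heights `passHeight` increase with
`e`, so later edges lie weakly above earlier ones and touch them only at a shared vertex: the
drawing is planar and uphill. Bends occur only next to the ends of the edge or where visited and
unvisited positions alternate, so `R` bounds on `rises` give `4 * R + 4` bends (`exists_drawing`).

It remains to choose a common order of the points with few rises. Sorting by color, and by time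
within a color, leaves rises only at color boundaries. Alternatively, color-preserving bijections
identify the vertices of the `k` paths, so that each becomes a point of a `k`-dimensional grid cut
into `m ^ k` cells of side `s`. Sorting by cell gives at most `m ^ k` rises between cells, and at
most `s` within cells, since these lie in the slab of times containing `e`. With `m` about `n ^ (1 /
(k + 1))` the total is `O(n ^ (k / (k + 1)))`, and `k + 1 ≤ 2 ^ k` yields the stated exponent. -/

namespace SimEmbed

/-! ### Piecewise affine interpolation -/

/-- The piecewise affine function on `[0, ∞)` with the value `h j` at every natural number `j`. -/
noncomputable def interp (h : ℕ → ℝ) (x : ℝ) : ℝ :=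
  AffineMap.lineMap (h ⌊x⌋₊) (h (⌊x⌋₊ + 1)) (x - (⌊x⌋₊ : ℝ))

theorem interp_eq (h : ℕ → ℝ) (i : ℕ) {x : ℝ} (h1 : (i : ℝ) ≤ x) (h2 : x ≤ i + 1) :
    interp h x = h i + (x - i) * (h (i + 1) - h i) := by
  rcases h2.lt_or_eq with h2 | rfl
  · have : ⌊x⌋₊ = i := (Nat.floor_eq_iff ((Nat.cast_nonneg i).trans h1)).2 ⟨h1, h2⟩
    simp [interp, this, AffineMap.lineMap_apply]; ring
  · have : ⌊(i : ℝ) + 1⌋₊ = i + 1 := by exact_mod_cast Nat.floor_natCast (R := ℝ) (i + 1)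
    simp [interp, this, AffineMap.lineMap_apply]

theorem interp_natCast (h : ℕ → ℝ) (i : ℕ) : interp h i = h i := by
  rw [interp_eq h i le_rfl (by simp)]; simp

theorem Polyline.eval_eq_interp (P : Polyline) (t : ℝ) :
    P.eval t = (interp (fun i => (P.pt i).1) t, interp (fun i => (P.pt i).2) t) := by
  ext <;> simp [Polyline.eval, interp, AffineMap.lineMap_apply]

theorem interp_le_interp {g h : ℕ → ℝ} (hgh : ∀ j, g j ≤ h j) {x : ℝ} (hx : 0 ≤ x) :
    interp g x ≤ interp h x := by
  have h1 := Nat.floor_le hx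
  have h2 := (Nat.lt_floor_add_one x).le
  rw [interp_eq g _ h1 h2, interp_eq h _ h1 h2]
  nlinarith [mul_le_mul_of_nonneg_left (hgh ⌊x⌋₊) (sub_nonneg.2 h2),
    mul_le_mul_of_nonneg_left (hgh (⌊x⌋₊ + 1)) (sub_nonneg.2 h1)]

/-- Where the interpolations of two ordered sequences agree, the sequences agree at the
neighbouring natural numbers. -/
theorem eq_of_interp_eq {g h : ℕ → ℝ} (hgh : ∀ j, g j ≤ h j) {x : ℝ} (hx : 0 ≤ x)
    (heq : interp g x = interp h x) :
    g ⌊x⌋₊ = h ⌊x⌋₊ ∧ (x = ⌊x⌋₊ ∨ g (⌊x⌋₊ + 1) = h (⌊x⌋₊ + 1)) := by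
  have h1 := Nat.floor_le hx
  have h2 := Nat.lt_floor_add_one x
  rw [interp_eq g _ h1 h2.le, interp_eq h _ h1 h2.le] at heq
  have a1 := mul_nonneg (sub_nonneg.2 h2.le) (sub_nonneg.2 (hgh ⌊x⌋₊))
  have a2 := mul_nonneg (sub_nonneg.2 h1) (sub_nonneg.2 (hgh (⌊x⌋₊ + 1)))
  constructor
  -- The difference of the interpolations is a sum of two nonnegative terms, so both vanish; the
  -- weight at the floor is positive, the other one vanishes only at an integer.
  · have : ((⌊x⌋₊ : ℝ) + 1 - x) * (h ⌊x⌋₊ - g ⌊x⌋₊) = 0 := by linarith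
    rcases mul_eq_zero.1 this with h0 | h0 <;> linarith
  · have : (x - (⌊x⌋₊ : ℝ)) * (h (⌊x⌋₊ + 1) - g (⌊x⌋₊ + 1)) = 0 := by linarith
    rcases mul_eq_zero.1 this with h0 | h0
    · left; linarith
    · right; linarith

theorem interp_strictMonoOn {u : ℕ → ℝ} (hu : StrictMono u) :
    StrictMonoOn (interp u) (Set.Ici 0) := by
  intro s hs t ht hst
  have s1 := Nat.floor_le (show (0 : ℝ) ≤ s from hs)
  have s2 := Nat.lt_floor_add_one s
  have t1 := Nat.floor_le (show (0 : ℝ) ≤ t from ht)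
  have t2 := Nat.lt_floor_add_one t
  rcases (Nat.floor_mono hst.le).eq_or_lt with h | h
  · rw [← h] at t1 t2
    rw [interp_eq u _ s1 s2.le, interp_eq u _ t1 t2.le]
    have := hu (Nat.lt_succ_self ⌊s⌋₊)
    have := mul_lt_mul_of_pos_right hst (sub_pos.2 this)
    simp only [Nat.succ_eq_add_one] at this
    linarith
  · rw [interp_eq u _ s1 s2.le, interp_eq u _ t1 t2.le]
    have e1 := hu (Nat.lt_succ_self ⌊s⌋₊)
    have e2 := hu (Nat.lt_succ_self ⌊t⌋₊)
    have e3 : u (⌊s⌋₊ + 1) ≤ u ⌊t⌋₊ := hu.monotone h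
    simp only [Nat.succ_eq_add_one] at e1 e2
    have a1 := mul_pos (sub_pos.2 s2) (sub_pos.2 e1)
    have a2 := mul_nonneg (sub_nonneg.2 t1) (sub_pos.2 e2).le
    linarith

theorem interp_reverse (g : ℕ → ℝ) (m : ℕ) {t : ℝ} (ht : t ∈ Set.Icc (0 : ℝ) (m + 1)) :
    interp (fun i => g (m + 1 - i)) t = interp g (m + 1 - t) := by
  rcases ht.2.eq_or_lt with rfl | hlt
  · have h1 := interp_natCast (fun i => g (m + 1 - i)) (m + 1)
    have h2 := interp_natCast g 0
    push_cast at h1 h2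
    rw [h1, sub_self, h2, Nat.sub_self]
  · have t1 := Nat.floor_le ht.1
    have t2 := Nat.lt_floor_add_one t
    have hm : ⌊t⌋₊ ≤ m := by
      have : (⌊t⌋₊ : ℝ) < (m + 1 : ℕ) := by push_cast; linarith
      exact Nat.lt_succ_iff.1 (by exact_mod_cast this)
    obtain ⟨d, hd⟩ := Nat.exists_eq_add_of_le hm
    have hd' : (m : ℝ) = ⌊t⌋₊ + d := by exact_mod_cast hd
    rw [interp_eq _ _ t1 t2.le, interp_eq g d (by linarith) (by linarith)]
    have e1 : m + 1 - ⌊t⌋₊ = d + 1 := by omega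
    have e2 : m + 1 - (⌊t⌋₊ + 1) = d := by omega
    simp only [e1, e2, hd']
    ring

/-! ### Corners, and polylines along graphs -/

/-- The sequence `h` has a corner at `j`. -/
def IsBent (h : ℕ → ℝ) (j : ℕ) : Prop := h j - h (j - 1) ≠ h (j + 1) - h j

theorem eq_affine_of_not_isBent {h : ℕ → ℝ} {p q : ℕ}
    (hb : ∀ j, p < j → j < q → ¬ IsBent h j) (i : ℕ) (hi : p + i + 1 ≤ q) :
    h (p + i) = h p + i * (h (p + 1) - h p) ∧
      h (p + i + 1) - h (p + i) = h (p + 1) - h p := by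
  induction i with
  | zero => simp
  | succ i ih =>
    obtain ⟨h1, h2⟩ := ih (by omega)
    have h3 := not_not.1 (hb (p + (i + 1)) (by omega) (by omega))
    have e : p + (i + 1) - 1 = p + i := by omega
    rw [e] at h3
    rw [← add_assoc] at h3 ⊢
    push_cast
    constructor <;> linarith

theorem interp_eq_of_not_isBent {h : ℕ → ℝ} {p q : ℕ} (hpq : p < q)
    (hb : ∀ j, p < j → j < q → ¬ IsBent h j) {x : ℝ} (h1 : (p : ℝ) ≤ x) (h2 : x ≤ q) :
    interp h x = h p + (x - p) * (h (p + 1) - h p) := by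
  have aux : ∀ i : ℕ, p + i + 1 ≤ q → ∀ y : ℝ, ((p + i : ℕ) : ℝ) ≤ y → y ≤ (p + i : ℕ) + 1 →
      interp h y = h p + (y - p) * (h (p + 1) - h p) := by
    intro i hi y y1 y2
    obtain ⟨e1, e2⟩ := eq_affine_of_not_isBent hb i hi
    rw [interp_eq h _ y1 y2, e2, e1]
    push_cast
    ring
  rcases h2.eq_or_lt with rfl | hlt
  · have e : p + (q - 1 - p) + 1 = q := by omega
    have e' : ((p + (q - 1 - p) : ℕ) : ℝ) + 1 = q := by exact_mod_cast e
    exact aux (q - 1 - p) (by omega) _ (by linarith) e'.ge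
  · have x0 : (0 : ℝ) ≤ x := le_trans (by positivity) h1
    have hp : p ≤ ⌊x⌋₊ := Nat.le_floor h1
    have hq : ⌊x⌋₊ < q := (Nat.floor_lt x0).2 hlt
    have e : p + (⌊x⌋₊ - p) = ⌊x⌋₊ := by omega
    refine aux (⌊x⌋₊ - p) (by omega) x ?_ ?_ <;> rw [e]
    · exact Nat.floor_le x0
    · exact (Nat.lt_floor_add_one x).le

/-- The natural numbers between `a` and `b` at which `h` has no corner can be skipped. -/
theorem exists_strictMono_corners (h : ℕ → ℝ) {a b : ℕ} (hab : a < b) :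
    ∃ (m : ℕ) (u : ℕ → ℕ), StrictMono u ∧ u 0 = a ∧ u (m + 1) = b ∧
      m = {j | a < j ∧ j < b ∧ IsBent h j}.ncard ∧
      ∀ i ≤ m, ∀ j, u i < j → j < u (i + 1) → ¬ IsBent h j := by
  classical
  -- The tail `b ≤ j` makes the set infinite, so that `Nat.nth` enumerates it strictly increasingly:
  -- `a`, the corners, then `b`.
  let p : ℕ → Prop := fun j => j = a ∨ (a < j ∧ j < b ∧ IsBent h j) ∨ b ≤ j
  have hinf : {j | p j}.Infinite := (Set.Ici_infinite b).mono fun j hj => Or.inr (Or.inr hj)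
  have hm : Nat.count p b = {j | a < j ∧ j < b ∧ IsBent h j}.ncard + 1 := by
    have hfin : {j | a < j ∧ j < b ∧ IsBent h j}.Finite :=
      (Set.finite_Iio b).subset fun j hj => hj.2.1
    rw [← Set.ncard_insert_of_notMem (a := a) (by simp) hfin, Nat.count_eq_card_filter_range,
      ← Set.ncard_coe_finset]
    congr 1
    ext j
    simp only [Finset.coe_filter, Finset.mem_range, Set.mem_ofPred_eq, Set.mem_insert_iff, p]
    constructor
    · rintro ⟨h1, h2 | h2 | h2⟩
      · exact Or.inl h2
      · exact Or.inr h2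
      · omega
    · rintro (rfl | h2)
      · exact ⟨hab, Or.inl rfl⟩
      · exact ⟨h2.2.1, Or.inr (Or.inl h2)⟩
  have ha : Nat.count p a = 0 := by
    rw [Nat.count_eq_card_filter_range, Finset.card_eq_zero, Finset.filter_eq_empty_iff]
    intro j hj
    rw [Finset.mem_range] at hj
    simp only [p]
    omega
  have hb : Nat.nth p (Nat.count p b) = b := Nat.nth_count (Or.inr (Or.inr le_rfl))
  have hmono := Nat.nth_strictMono hinf
  refine ⟨_, Nat.nth p, hmono, ?_, ?_, rfl, ?_⟩
  · rw [← ha]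
    exact Nat.nth_count (Or.inl rfl)
  · rw [← hm]
    exact hb
  · intro i hi j h1 h2 hbent
    have hj : p j := by
      refine Or.inr (Or.inl ⟨?_, ?_, hbent⟩)
      · refine lt_of_le_of_lt ?_ h1
        calc a = Nat.nth p 0 := by rw [← ha]; exact (Nat.nth_count (Or.inl rfl)).symm
          _ ≤ _ := hmono.monotone (Nat.zero_le _)
      · refine lt_of_lt_of_le h2 ?_
        calc _ ≤ Nat.nth p (Nat.count p b) := hmono.monotone (by omega)
          _ = b := hb
    rw [← Nat.nth_count hj] at h1 h2
    have := hmono.lt_iff_lt.1 h1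
    have := hmono.lt_iff_lt.1 h2
    omega

/-- The polyline is drawn along the graph of the interpolation of `h`, without turning back. -/
structure Polyline.IsGraphOf (P : Polyline) (h : ℕ → ℝ) : Prop where
  nonneg : ∀ t ∈ P.dom, 0 ≤ (P.eval t).1
  snd_eq : ∀ t ∈ P.dom, (P.eval t).2 = interp h (P.eval t).1
  injOn : Set.InjOn (fun t => (P.eval t).1) P.dom

theorem exists_isGraphOf_of_lt (h : ℕ → ℝ) {a b : ℕ} (hab : a < b) :
    ∃ P : Polyline, P.pt 0 = ((a : ℝ), h a) ∧ P.pt (P.bends + 1) = ((b : ℝ), h b) ∧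
      P.bends = {j | a < j ∧ j < b ∧ IsBent h j}.ncard ∧ P.IsGraphOf h := by
  obtain ⟨m, u, hu, hua, hub, hm, hbent⟩ := exists_strictMono_corners h hab
  have hu' : StrictMono fun i => (u i : ℝ) := fun i j hij => Nat.cast_lt.2 (hu hij)
  refine ⟨⟨m, fun i => ((u i : ℝ), h (u i))⟩, by simp [hua], by simp [hub], hm, ?_⟩
  have hseg : ∀ t ∈ Set.Icc (0 : ℝ) (m + 1), ∃ i ≤ m, (i : ℝ) ≤ t ∧ t ≤ i + 1 := by
    rintro t ⟨t0, t1⟩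
    rcases t1.eq_or_lt with rfl | t1
    · exact ⟨m, le_rfl, by linarith, le_rfl⟩
    · refine ⟨⌊t⌋₊, ?_, Nat.floor_le t0, (Nat.lt_floor_add_one t).le⟩
      refine Nat.lt_succ_iff.1 ((Nat.floor_lt t0).2 ?_)
      push_cast
      exact t1
  have hspan : ∀ i : ℕ, (u i : ℝ) < u (i + 1) := fun i => hu' (Nat.lt_succ_self i)
  constructor
  · intro t ht
    obtain ⟨i, hi, h1, h2⟩ := hseg t ht
    rw [Polyline.eval_eq_interp]
    simp only
    rw [interp_eq _ i h1 h2]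
    have := mul_nonneg (sub_nonneg.2 h1) (sub_pos.2 (hspan i)).le
    positivity
  · intro t ht
    obtain ⟨i, hi, h1, h2⟩ := hseg t ht
    rw [Polyline.eval_eq_interp]
    simp only
    rw [interp_eq _ i h1 h2, interp_eq _ i h1 h2]
    have hs := sub_pos.2 (hspan i)
    have hb := hbent i hi
    have hi1 : u i < u (i + 1) := hu (Nat.lt_succ_self i)
    rw [interp_eq_of_not_isBent hi1 hb (by nlinarith) (by nlinarith),
      ← interp_natCast h (u (i + 1)), interp_eq_of_not_isBent hi1 hb (hspan i).le le_rfl]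
    ring
  · intro s hs t ht hst
    simp only [Polyline.eval_eq_interp] at hst
    exact (interp_strictMonoOn hu').injOn hs.1 ht.1 hst

theorem Polyline.IsGraphOf.reverse {P : Polyline} {h : ℕ → ℝ} (hP : P.IsGraphOf h) :
    Polyline.IsGraphOf ⟨P.bends, fun i => P.pt (P.bends + 1 - i)⟩ h := by
  have hdom : ∀ t ∈ P.dom, (P.bends : ℝ) + 1 - t ∈ P.dom := by
    rintro t ⟨h0, h1⟩
    constructor <;> linarith
  have heval : ∀ t ∈ P.dom,
      Polyline.eval ⟨P.bends, fun i => P.pt (P.bends + 1 - i)⟩ t = P.eval (P.bends + 1 - t) := by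
    intro t ht
    simp only [Polyline.eval_eq_interp]
    rw [interp_reverse (fun i => (P.pt i).1) _ ht, interp_reverse (fun i => (P.pt i).2) _ ht]
  constructor
  · intro t ht
    rw [heval t ht]
    exact hP.nonneg _ (hdom t ht)
  · intro t ht
    rw [heval t ht]
    exact hP.snd_eq _ (hdom t ht)
  · intro s hs t ht hst
    simp only [heval s hs, heval t ht] at hst
    have := hP.injOn (hdom s hs) (hdom t ht) hst
    linarith

theorem exists_isGraphOf (h : ℕ → ℝ) {a b : ℕ} (hab : a ≠ b) :
    ∃ P : Polyline, P.pt 0 = ((a : ℝ), h a) ∧ P.pt (P.bends + 1) = ((b : ℝ), h b) ∧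
      P.bends = {j | min a b < j ∧ j < max a b ∧ IsBent h j}.ncard ∧ P.IsGraphOf h := by
  rcases hab.lt_or_gt with hab | hab
  · rw [min_eq_left hab.le, max_eq_right hab.le]
    exact exists_isGraphOf_of_lt h hab
  · rw [min_eq_right hab.le, max_eq_left hab.le]
    obtain ⟨P, h1, h2, h3, h4⟩ := exists_isGraphOf_of_lt h hab
    exact ⟨⟨P.bends, fun i => P.pt (P.bends + 1 - i)⟩, by simpa using h2, by simpa using h1, h3,
      h4.reverse⟩


/-! ### Heights of the edges over the vertices -/

/-- The height at which the edge `e` of a path with `n` vertices passes a vertex visited at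
time `T`. -/
noncomputable def passHeight (n e T : ℕ) : ℝ :=
  if T < e then (e : ℝ) + 1 else if T ≤ e + 1 then 0 else (e : ℝ) - n

/-- As `e` grows, a vertex turns from later to end to earlier, with negative, zero and positive
height; within the first and last regime the height itself increases with `e`. -/
theorem passHeight_mono {n e e' : ℕ} (h : e < e') (hn : e' < n) (T : ℕ) :
    passHeight n e T ≤ passHeight n e' T := by
  have h1 : (e : ℝ) < e' := by exact_mod_cast h
  have h2 : (e' : ℝ) < n := by exact_mod_cast hn
  have h3 : (0 : ℝ) ≤ e := by positivity
  unfold passHeight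
  split_ifs <;> linarith

theorem eq_of_passHeight_eq {n e e' T : ℕ} (h : e < e') (hn : e' < n)
    (heq : passHeight n e T = passHeight n e' T) : T = e' ∧ e' = e + 1 := by
  have h1 : (e : ℝ) < e' := by exact_mod_cast h
  have h2 : (e' : ℝ) < n := by exact_mod_cast hn
  have h3 : (0 : ℝ) ≤ e := by positivity
  unfold passHeight at heq
  split_ifs at heq <;> first | (exfalso; linarith) | omega

theorem passHeight_eq_zero {n e T : ℕ} (hn : e < n) (h : passHeight n e T = 0) :
    T = e ∨ T = e + 1 := by
  have h2 : (e : ℝ) < n := by exact_mod_cast hn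
  have h3 : (0 : ℝ) ≤ e := by positivity
  unfold passHeight at h
  split_ifs at h <;> first | (exfalso; linarith) | omega

theorem passHeight_of_ne (n : ℕ) {e T : ℕ} (h1 : T ≠ e) (h2 : T ≠ e + 1) :
    passHeight n e T = if T ≤ e then (e : ℝ) + 1 else (e : ℝ) - n := by
  unfold passHeight
  split_ifs <;> first | rfl | omega

/-! ### Visited positions and bend counts -/

variable {n : ℕ}

/-- The time at which the `j`-th position is visited, with value `n` for `j ≥ n`. -/
def visitTime (τ : Equiv.Perm (Fin n)) (j : ℕ) : ℕ := if h : j < n then (τ ⟨j, h⟩ : ℕ) else n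

theorem visitTime_coe (τ : Equiv.Perm (Fin n)) (j : Fin n) : visitTime τ j = τ j := by
  simp [visitTime]

theorem eq_symm_of_visitTime_eq {τ : Equiv.Perm (Fin n)} {j : ℕ} {v : Fin n}
    (h : visitTime τ j = v) : j = τ.symm v := by
  unfold visitTime at h
  split_ifs at h with hj
  · rw [← Fin.ext h, Equiv.symm_apply_apply]
  · exact absurd h v.2.ne'

/-- The positions `j` such that `j + 1` is visited at time `e` or before, but `j` is not. -/
def rises (τ : Equiv.Perm (Fin n)) (e : ℕ) : Set ℕ :=
  {j | j + 1 < n ∧ visitTime τ (j + 1) ≤ e ∧ e < visitTime τ j}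

/-- The positions `j` such that exactly one of `j` and `j + 1` is visited at time `e` or before. -/
def alternations (τ : Equiv.Perm (Fin n)) (e : ℕ) : Set ℕ :=
  {j | j + 1 < n ∧ ¬ (visitTime τ j ≤ e ↔ visitTime τ (j + 1) ≤ e)}

theorem alternations_finite (τ : Equiv.Perm (Fin n)) (e : ℕ) : (alternations τ e).Finite :=
  (Set.finite_Iio n).subset fun _ hj => (Nat.lt_succ_self _).trans hj.1

/-- Rises and falls of the indicator of the visited positions alternate, so their numbers differ by
at most one; this is read off a telescoping sum. -/
theorem ncard_alternations_le (τ : Equiv.Perm (Fin n)) (e : ℕ) :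
    (alternations τ e).ncard ≤ 2 * (rises τ e).ncard + 1 := by
  classical
  let s : ℕ → ℤ := fun j => if visitTime τ j ≤ e then 1 else 0
  let R := (Finset.range (n - 1)).filter fun j => visitTime τ (j + 1) ≤ e ∧ e < visitTime τ j
  let A := (Finset.range (n - 1)).filter fun j => ¬ (visitTime τ j ≤ e ↔ visitTime τ (j + 1) ≤ e)
  have hR : rises τ e = R := by
    ext j
    simp only [rises, Set.mem_ofPred_eq, R, Finset.coe_filter, Finset.mem_range]
    omega
  have hA : alternations τ e = A := by
    ext j
    simp only [alternations, Set.mem_ofPred_eq, A, Finset.coe_filter, Finset.mem_range]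
    omega
  rw [hR, hA, Set.ncard_coe_finset, Set.ncard_coe_finset]
  have hsum := Finset.sum_range_sub s (n - 1)
  have hterm : ∑ j ∈ Finset.range (n - 1), (s (j + 1) - s j) = 2 * (R.card : ℤ) - A.card := by
    rw [Finset.card_filter, Finset.card_filter]
    push_cast
    rw [Finset.mul_sum, ← Finset.sum_sub_distrib]
    refine Finset.sum_congr rfl fun j _ => ?_
    simp only [s]
    split_ifs <;> omega
  have h0 : s 0 ≤ 1 := by simp only [s]; split_ifs <;> simp
  have h1 : 0 ≤ s (n - 1) := by simp only [s]; split_ifs <;> simp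
  omega

/-- The heights at which the edge `e` passes the positions. -/
noncomputable def edgeHeight (τ : Equiv.Perm (Fin n)) (e j : ℕ) : ℝ :=
  passHeight n e (visitTime τ j)

theorem edgeHeight_fst (τ : Equiv.Perm (Fin n)) (e : Fin (n - 1)) :
    edgeHeight τ e (τ.symm (edgeFst e)) = 0 := by
  simp [edgeHeight, visitTime_coe, passHeight, edgeFst]

theorem edgeHeight_snd (τ : Equiv.Perm (Fin n)) (e : Fin (n - 1)) :
    edgeHeight τ e (τ.symm (edgeSnd e)) = 0 := by
  simp [edgeHeight, visitTime_coe, passHeight, edgeSnd]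

theorem ncard_isBent_le (τ : Equiv.Perm (Fin n)) (e : Fin (n - 1)) (a b : Fin n)
    (ha : τ a = edgeFst e) (hb : τ b = edgeSnd e) :
    {j | min (a : ℕ) b < j ∧ j < max (a : ℕ) b ∧ IsBent (edgeHeight τ e) j}.ncard ≤
      2 + 2 * (alternations τ e).ncard := by
  set A := alternations τ e
  have hA : A.Finite := alternations_finite τ e
  have hT : ∀ j : ℕ, j < n → j ≠ a → j ≠ b → visitTime τ j ≠ e ∧ visitTime τ j ≠ e + 1 := by
    intro j hj hja hjb
    refine ⟨fun h => hja ?_, fun h => hjb ?_⟩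
    · rw [eq_symm_of_visitTime_eq (v := edgeFst e) h, ← ha, Equiv.symm_apply_apply]
    · rw [eq_symm_of_visitTime_eq (v := edgeSnd e) h, ← hb, Equiv.symm_apply_apply]
  -- Away from the end vertices the height depends only on whether the position is visited, so
  -- without a nearby alternation it is constant on three consecutive positions.
  have hsub : {j | min (a : ℕ) b < j ∧ j < max (a : ℕ) b ∧ IsBent (edgeHeight τ e) j} ⊆
      {min (a : ℕ) b + 1, max (a : ℕ) b - 1} ∪ (A ∪ (fun j => j + 1) '' A) := by
    rintro j ⟨h1, h2, h3⟩
    by_contra hj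
    simp only [Set.mem_union, Set.mem_insert_iff, Set.mem_singleton_iff, Set.mem_image,
      not_or, not_exists, not_and] at hj
    obtain ⟨⟨j1, j2⟩, j3, j4⟩ := hj
    have jn := a.2
    have jn' := b.2
    obtain ⟨i, rfl⟩ : ∃ i, j = i + 1 := ⟨j - 1, by omega⟩
    have j5 : i ∉ A := fun hi => j4 i hi rfl
    simp only [A, alternations, Set.mem_ofPred_eq, not_and, not_not] at j3 j5
    have t1 := hT i (by omega) (by omega) (by omega)
    have t2 := hT (i + 1) (by omega) (by omega) (by omega)
    have t3 := hT (i + 1 + 1) (by omega) (by omega) (by omega)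
    replace j3 := j3 (by omega)
    replace j5 := j5 (by omega)
    apply h3
    rw [Nat.add_sub_cancel]
    simp only [edgeHeight, passHeight_of_ne n t1.1 t1.2, passHeight_of_ne n t2.1 t2.2,
      passHeight_of_ne n t3.1 t3.2, j3, j5, sub_self]
  refine (Set.ncard_le_ncard hsub (by
    exact (Set.toFinite _).union (hA.union (hA.image _)))).trans ?_
  refine (Set.ncard_union_le _ _).trans ?_
  have h1 := Set.ncard_insert_le (min (a : ℕ) b + 1) {max (a : ℕ) b - 1}
  rw [Set.ncard_singleton] at h1
  have h2 := Set.ncard_union_le A ((fun j => j + 1) '' A)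
  have h3 := Set.ncard_image_le (f := fun j => j + 1) hA
  omega

/-- Where the curves of two edges agree, they pass through a common end vertex. -/
theorem exists_vertex_of_interp_eq (τ : Equiv.Perm (Fin n)) {e e' : Fin (n - 1)} (h : e < e')
    {x : ℝ} (hx : 0 ≤ x) (heq : interp (edgeHeight τ e) x = interp (edgeHeight τ e') x) :
    edgeSnd e = edgeFst e' ∧ x = (τ.symm (edgeFst e') : ℕ) ∧ interp (edgeHeight τ e') x = 0 := by
  have hn : (e' : ℕ) < n := by omega
  have hv : ∀ j, edgeHeight τ e j = edgeHeight τ e' j →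
      j = τ.symm (edgeFst e') ∧ (e' : ℕ) = e + 1 := fun j hj =>
    have := eq_of_passHeight_eq h hn hj
    ⟨eq_symm_of_visitTime_eq this.1, this.2⟩
  obtain ⟨h1, h2⟩ := eq_of_interp_eq (fun j => passHeight_mono h hn _) hx heq
  obtain ⟨h3, h4⟩ := hv _ h1
  have hx' : x = (τ.symm (edgeFst e') : ℕ) := by
    -- For non-integral `x` the curves would agree at two consecutive positions, but the shared
    -- vertex occupies only one.
    rcases h2 with h2 | h2
    · rw [← h3]
      exact h2
    · have := (hv _ h2).1
      omega
  refine ⟨Fin.ext h4.symm, hx', ?_⟩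
  rw [hx', interp_natCast, edgeHeight_fst]

theorem Polyline.IsGraphOf.of_mem_carrier {P : Polyline} {h : ℕ → ℝ} (hP : P.IsGraphOf h)
    {p : ℝ × ℝ} (hp : p ∈ P.carrier) : 0 ≤ p.1 ∧ p.2 = interp h p.1 := by
  obtain ⟨t, ht, rfl⟩ := hp
  exact ⟨hP.nonneg t ht, hP.snd_eq t ht⟩

/-- A path can be drawn uphill on collinear points, in any order of these points, with few bends
if the set of visited points never splits into many intervals. -/
theorem exists_drawing (τ : Equiv.Perm (Fin n)) {R : ℕ} (hR : ∀ e, (rises τ e).ncard ≤ R) :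
    ∃ D : PathDrawing n, (∀ v, D.loc v = (((τ.symm v : ℕ) : ℝ), 0)) ∧ D.IsPlanar ∧
      D.IsUphill ∧ ∀ e, (D.edge e).bends ≤ 4 * R + 4 := by
  have hne : ∀ e : Fin (n - 1),
      ((τ.symm (edgeFst e) : Fin n) : ℕ) ≠ (τ.symm (edgeSnd e) : Fin n) := by
    intro e h
    have := congrArg Fin.val (τ.symm.injective (Fin.ext h))
    simp [edgeFst, edgeSnd] at this
  choose P hP0 hP1 hPb hPg using fun e : Fin (n - 1) => exists_isGraphOf (edgeHeight τ e) (hne e)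
  let D : PathDrawing n :=
    { loc := fun v => (((τ.symm v : ℕ) : ℝ), 0)
      edge := P
      edge_source := fun e => by rw [hP0, edgeHeight_fst]
      edge_target := fun e => by rw [hP1, edgeHeight_snd] }
  have hinter : ∀ e e', e < e' → ∀ p ∈ (P e).carrier ∩ (P e').carrier,
      Incident (edgeFst e') e ∧ p = D.loc (edgeFst e') := by
    rintro e e' hlt p ⟨h1, h2⟩
    obtain ⟨h3, h4⟩ := (hPg e).of_mem_carrier h1
    obtain ⟨-, h5⟩ := (hPg e').of_mem_carrier h2
    obtain ⟨h6, h7, h8⟩ := exists_vertex_of_interp_eq τ hlt h3 (h4.symm.trans h5)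
    exact ⟨Or.inr h6.symm, Prod.ext h7 (h5.trans h8)⟩
  refine ⟨D, fun v => rfl, ⟨?_, ?_, ?_, ?_⟩, ?_, ?_⟩
  · intro v w h
    have := congrArg Prod.fst h
    simp only [D, Nat.cast_inj] at this
    exact τ.symm.injective (Fin.ext this)
  · intro e s hs t ht hst
    exact (hPg e).injOn hs ht (congrArg Prod.fst hst)
  · intro v e hv
    have h := ((hPg e).of_mem_carrier hv).2
    simp only [D, interp_natCast, edgeHeight, visitTime_coe, Equiv.apply_symm_apply] at h
    rcases passHeight_eq_zero (by omega) h.symm with h | h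
    · exact Or.inl (Fin.ext h)
    · exact Or.inr (Fin.ext h)
  · intro e e' hee p hp
    rcases hee.lt_or_gt with hlt | hlt
    · obtain ⟨h1, h2⟩ := hinter e e' hlt p hp
      exact ⟨_, h1, Or.inl rfl, h2⟩
    · obtain ⟨h1, h2⟩ := hinter e' e hlt p ⟨hp.2, hp.1⟩
      exact ⟨_, Or.inl rfl, h1, h2⟩
  · intro e t ht
    rw [Set.disjoint_left]
    rintro p ⟨hp1, hp2⟩ hp
    rcases hp with hp | ⟨s, hs, rfl⟩
    -- Earlier edges lie weakly below the current one over every abscissa.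
    · simp only [Set.mem_iUnion] at hp
      obtain ⟨e', he', hp⟩ := hp
      obtain ⟨h1, h2⟩ := (hPg e').of_mem_carrier hp
      have h3 := (hPg e).snd_eq t ht
      rw [← hp1] at h3
      have h4 : interp (edgeHeight τ e') p.1 ≤ interp (edgeHeight τ e) p.1 :=
        interp_le_interp (fun j => passHeight_mono (Set.mem_Iio.1 he') (by omega) _) h1
      simp only [D] at hp2
      linarith
    -- The current edge is monotone in the abscissa, so it meets a vertical line only once.
    · have hst := (hPg e).injOn ⟨hs.1, hs.2.trans ht.2⟩ ht hp1
      rw [hst] at hp2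
      exact lt_irrefl _ hp2
  · intro e
    have h1 := ncard_isBent_le τ e _ _ (τ.apply_symm_apply (edgeFst e))
      (τ.apply_symm_apply (edgeSnd e))
    have h2 := ncard_alternations_le τ e
    have h3 := hR e
    have h4 := hPb e
    simp only [D]
    omega

/-! ### Common layouts with few rises -/

/-- If the positions are partitioned into `M` intervals by a monotone function `f`, then there is
at most one rise per boundary between two intervals, apart from the rises inside the intervals. -/
theorem ncard_rises_le (τ : Equiv.Perm (Fin n)) (e : ℕ) {M : ℕ} {f : Fin n → Fin M}
    (hf : Monotone f) {B : Set ℕ} (hB : B.Finite)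
    (h : ∀ j, (hj : j ∈ rises τ e) → f ⟨j, by have := hj.1; omega⟩ = f ⟨j + 1, hj.1⟩ → j ∈ B) :
    (rises τ e).ncard ≤ M + B.ncard := by
  classical
  let g : ℕ → ℕ := fun j => if hj : j < n then f ⟨j, hj⟩ else 0
  have hg : ∀ j (hj : j < n), g j = f ⟨j, hj⟩ := fun j hj => dif_pos hj
  let S : Set ℕ := {j | j + 1 < n ∧ g j < g (j + 1)}
  have hS : S.ncard ≤ M := by
    have : (Set.Iio M).ncard = M := by
      rw [← Finset.coe_Iio, Set.ncard_coe_finset, Nat.card_Iio]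
    rw [← this]
    -- The interval to the left of a boundary determines the boundary, so `g` injects `S` into the
    -- `M` intervals.
    have hlt : ∀ i ∈ S, ∀ j ∈ S, i < j → g i < g j := by
      rintro i ⟨hi, hi'⟩ j ⟨hj, hj'⟩ hij
      refine hi'.trans_le ?_
      rw [hg _ hi, hg j (by omega)]
      exact hf (Fin.mk_le_mk.2 hij)
    refine Set.ncard_le_ncard_of_injOn g ?_ ?_ (Set.finite_Iio M)
    · rintro j ⟨hj, -⟩
      rw [hg j (by omega)]
      exact (f _).2
    · intro i hi j hj hij
      rcases lt_trichotomy i j with h | h | h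
      · exact absurd hij (hlt i hi j hj h).ne
      · exact h
      · exact absurd hij (hlt j hj i hi h).ne'
  have hsub : rises τ e ⊆ S ∪ B := by
    intro j hj
    have hj1 := hj.1
    have hle : f ⟨j, by omega⟩ ≤ f ⟨j + 1, hj1⟩ := hf (Fin.mk_le_mk.2 (by omega))
    rcases hle.lt_or_eq with hlt | heq
    · refine Or.inl ⟨hj1, ?_⟩
      rw [hg _ hj1, hg j (by omega)]
      exact hlt
    · exact Or.inr (h j hj heq)
  have hSfin : S.Finite := (Set.finite_Iio n).subset fun j hj => (Nat.lt_succ_self j).trans hj.1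
  calc (rises τ e).ncard ≤ (S ∪ B).ncard := Set.ncard_le_ncard hsub (hSfin.union hB)
    _ ≤ S.ncard + B.ncard := Set.ncard_union_le _ _
    _ ≤ M + B.ncard := by omega

theorem exists_perm_of_compatiblyColored {k c : ℕ} {Q : Fin k → SpinalPath n c}
    (hQ : CompatiblyColored Q) (i j : Fin k) :
    ∃ ρ : Equiv.Perm (Fin n), ∀ v, (Q j).color (ρ v) = (Q i).color v := by
  have he : ∀ q, Nonempty ({v // (Q i).color v = q} ≃ {v // (Q j).color v = q}) := fun q =>
    ⟨(Finite.equivFinOfCardEq (hQ q i j)).trans (Finite.equivFinOfCardEq rfl).symm⟩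
  let e := fun q => (he q).some
  exact ⟨Equiv.ofFiberEquiv e, fun v => Equiv.ofFiberEquiv_map e v⟩

/-- A common layout of the vertices in which they are sorted by color. -/
theorem exists_layout_by_color {k c : ℕ} {Q : Fin k → SpinalPath n c} (hQ : CompatiblyColored Q) :
    ∃ τ : Fin k → Equiv.Perm (Fin n),
      (∀ i j p, (Q i).color (τ i p) = (Q j).color (τ j p)) ∧
      ∀ i e, (rises (τ i) e).ncard ≤ c := by
  refine ⟨fun i => Tuple.sort (Q i).color, fun i j p => ?_, fun i e => ?_⟩
  · obtain ⟨ρ, hρ⟩ := exists_perm_of_compatiblyColored hQ i j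
    have h1 := Tuple.monotone_sort (Q i).color
    have h2 := Tuple.monotone_sort (Q j).color
    have h3 : (Q i).color ∘ Tuple.sort (Q i).color = (Q j).color ∘ (ρ * Tuple.sort (Q i).color) := by
      ext p
      simp [hρ]
    rw [h3] at h1
    -- The color counts determine the sorted color sequence, so it is the same for all paths.
    have := congrFun (Tuple.unique_monotone h1 h2) p
    rw [← h3] at this
    exact this
  · obtain ⟨h1, h2⟩ := Tuple.eq_sort_iff.1 (rfl : Tuple.sort (Q i).color = Tuple.sort (Q i).color)
    have := ncard_rises_le (Tuple.sort (Q i).color) e h1 Set.finite_empty (by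
      rintro j ⟨hj, hj1, hj2⟩ heq
      -- `Tuple.sort` breaks ties by index, so visit times increase within a color and no rise
      -- occurs there.
      have hlt := h2 ⟨j, by omega⟩ ⟨j + 1, hj⟩ (Fin.mk_lt_mk.2 (Nat.lt_succ_self j)) heq
      rw [← Fin.val_fin_lt] at hlt
      simp only [visitTime, hj, (Nat.lt_succ_self j).trans hj, dif_pos] at hj1 hj2
      omega)
    simpa using this

/-- A common layout of the vertices in which they are sorted by the cells of a grid, where the
coordinates of a vertex are its positions on the paths. -/
theorem exists_layout_by_cell {k c : ℕ} {Q : Fin k → SpinalPath n c} (hQ : CompatiblyColored Q)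
    {s m : ℕ} (hs : 0 < s) (hsm : n ≤ s * m) :
    ∃ τ : Fin k → Equiv.Perm (Fin n),
      (∀ i j p, (Q i).color (τ i p) = (Q j).color (τ j p)) ∧
      ∀ i e, (rises (τ i) e).ncard ≤ m ^ k + s := by
  rcases isEmpty_or_nonempty (Fin k) with hk | ⟨⟨i₀⟩⟩
  · exact ⟨fun i => 1, fun i => hk.elim i, fun i => hk.elim i⟩
  choose ρ hρ using fun i => exists_perm_of_compatiblyColored hQ i₀ i
  let cell : Fin n → Fin (m ^ k) := fun v =>
    finFunctionFinEquiv fun i => ⟨(ρ i v : ℕ) / s, Nat.div_lt_of_lt_mul ((ρ i v).2.trans_le hsm)⟩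
  have hcell : ∀ v w, cell v = cell w → ∀ i, (ρ i v : ℕ) / s = (ρ i w : ℕ) / s := by
    intro v w h i
    exact congrArg Fin.val (congrFun (finFunctionFinEquiv.injective h) i)
  refine ⟨fun i => ρ i * Tuple.sort cell, fun i j p => ?_, fun i e => ?_⟩
  · simp [hρ]
  · let τ := ρ i * Tuple.sort cell
    -- For a rise inside a cell, the two visit times share a slab of length `s` and straddle `e`, so
    -- this is the slab of `e`.
    let B : Set ℕ := {j | j < n ∧ visitTime τ j / s = e / s}
    have hB : B.Finite := (Set.finite_Iio n).subset fun j hj => hj.1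
    have hBs : B.ncard ≤ s := by
      have : (Set.Ico (e / s * s) (e / s * s + s)).ncard = s := by
        rw [← Finset.coe_Ico, Set.ncard_coe_finset, Nat.card_Ico]
        omega
      refine le_of_le_of_eq ?_ this
      refine Set.ncard_le_ncard_of_injOn (visitTime τ) ?_ ?_ (Set.finite_Ico _ _)
      · rintro j ⟨-, hj⟩
        rw [← hj]
        exact ⟨Nat.div_mul_le_self _ _, Nat.lt_div_mul_add hs⟩
      · rintro j ⟨hj, -⟩ l ⟨hl, -⟩ h
        simp only [visitTime, hj, hl, dif_pos] at h
        exact congrArg Fin.val (τ.injective (Fin.ext h))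
    have := ncard_rises_le τ e (Tuple.monotone_sort cell) hB (by
      rintro j ⟨hj, hj1, hj2⟩ heq
      have hjn : j < n := by omega
      have h := hcell _ _ heq i
      refine ⟨hjn, ?_⟩
      have e1 : visitTime τ j / s = visitTime τ (j + 1) / s := by
        simp only [visitTime, hj, hjn, dif_pos]
        exact h
      exact le_antisymm (e1.trans_le (Nat.div_le_div_right hj1)) (Nat.div_le_div_right hj2.le))
    exact this.trans (Nat.add_le_add_left hBs _)

/-! ### Assembling the drawings and choosing the grid -/

theorem exists_simultaneousDrawing {k c R : ℕ} {Q : Fin k → SpinalPath n c}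
    (τ : Fin k → Equiv.Perm (Fin n)) (hτ : ∀ i j p, (Q i).color (τ i p) = (Q j).color (τ j p))
    (hR : ∀ i e, (rises (τ i) e).ncard ≤ R) :
    ∃ D : Fin k → PathDrawing n, IsSimultaneousDrawing Q D ∧
      ∀ i, (D i).IsUphill ∧ ∀ e, ((D i).edge e).bends ≤ 4 * R + 4 := by
  choose D hloc hplanar hup hbends using fun i => exists_drawing (τ i) (hR i)
  refine ⟨D, ⟨hplanar, fun q i j => ?_⟩, fun i => ⟨hup i, hbends i⟩⟩
  have hsub : ∀ i j, (D i).loc '' {v | (Q i).color v = q} ⊆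
      (D j).loc '' {v | (Q j).color v = q} := by
    rintro i j _ ⟨v, hv, rfl⟩
    refine ⟨τ j ((τ i).symm v), ?_, by simp [hloc]⟩
    rw [Set.mem_ofPred_eq, hτ j i, Equiv.apply_symm_apply]
    exact hv
  exact (hsub i j).antisymm (hsub j i)

theorem exists_grid_size {n : ℕ} (hn : 1 ≤ n) (k : ℕ) :
    ∃ s m : ℕ, 0 < s ∧ n ≤ s * m ∧
      ((m ^ k + s : ℕ) : ℝ) ≤ 4 * (n : ℝ) ^ (1 - (1 / 2 : ℝ) ^ k) := by
  have hn' : (1 : ℝ) ≤ n := by exact_mod_cast hn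
  have hk : (0 : ℝ) < (k : ℝ) + 1 := by positivity
  -- This `r` balances the number `r ^ k` of cells against the slab length `n / r`.
  set r : ℝ := (n : ℝ) ^ (1 / ((k : ℝ) + 1)) with hr
  have hr1 : 1 ≤ r := Real.one_le_rpow hn' (by positivity)
  have hrk : r ^ k = (n : ℝ) ^ ((k : ℝ) / (k + 1)) := by
    rw [hr, ← Real.rpow_mul_natCast (by positivity)]
    congr 1
    ring
  have hrn : r ^ k * r = n := by
    rw [← pow_succ, hr, ← Real.rpow_mul_natCast (by positivity)]
    push_cast
    rw [one_div_mul_cancel hk.ne', Real.rpow_one]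
  have hle : r ^ k ≤ (n : ℝ) ^ (1 - (1 / 2 : ℝ) ^ k) := by
    rw [hrk]
    refine Real.rpow_le_rpow_of_exponent_le hn' ?_
    have h2 : (k : ℝ) + 1 ≤ 2 ^ k := by exact_mod_cast Nat.lt_two_pow_self (n := k)
    have h3 : (1 / 2 : ℝ) ^ k ≤ 1 / (k + 1) := by
      rw [one_div_pow]
      exact one_div_le_one_div_of_le hk h2
    have h4 : (k : ℝ) / (k + 1) = 1 - 1 / (k + 1) := by field_simp; ring
    linarith
  have hm1 : 1 ≤ ⌊r⌋₊ := Nat.le_floor (by simpa using hr1)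
  have hm1' : (1 : ℝ) ≤ ⌊r⌋₊ := by exact_mod_cast hm1
  have hmr : (⌊r⌋₊ : ℝ) ≤ r := Nat.floor_le (by linarith)
  have hrm : r ≤ 2 * ⌊r⌋₊ := by linarith [Nat.lt_floor_add_one r]
  refine ⟨n / ⌊r⌋₊ + 1, ⌊r⌋₊, Nat.succ_pos _, ?_, ?_⟩
  · have := Nat.lt_div_mul_add (a := n) hm1
    rw [add_mul, one_mul]
    exact this.le
  -- The factor 4 is 1 for the cells, 2 for the slab length after rounding `r` down, and 1 for the
  -- added unit in `s`.
  · have h1 : (⌊r⌋₊ : ℝ) ^ k ≤ r ^ k := pow_le_pow_left₀ (by positivity) hmr k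
    have h2 : ((n / ⌊r⌋₊ : ℕ) : ℝ) ≤ 2 * r ^ k := by
      refine Nat.cast_div_le.trans ?_
      rw [div_le_iff₀ (by linarith), ← hrn]
      nlinarith [mul_le_mul_of_nonneg_left hrm (show 0 ≤ r ^ k by positivity)]
    have h3 : 1 ≤ r ^ k := one_le_pow₀ hr1
    push_cast
    linarith

end SimEmbed

theorem mainTheorem3 :
    ∃ C : ℝ, 0 < C ∧ ∀ (k n c : ℕ) (α : ℝ), 0 ≤ α → α ≤ 1 → (c : ℝ) = (n : ℝ) ^ α →
      ∀ Q : Fin k → SimEmbed.SpinalPath n c, SimEmbed.CompatiblyColored Q →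
        ∃ D : Fin k → SimEmbed.PathDrawing n,
          SimEmbed.IsSimultaneousDrawing Q D ∧
          ∀ i : Fin k, (D i).IsUphill ∧
            ∀ e : Fin (n - 1), (((D i).edge e).bends : ℝ) ≤
              C * min ((n : ℝ) ^ α) ((n : ℝ) ^ (1 - (1 / 2 : ℝ) ^ k)) := by
  -- In the grid case `R` is at most `4 * X` with `X ≥ 1` the target power, so `4 * R + 4 ≤ 20 * X`;
  -- sorting by color needs only 8.
  refine ⟨20, by norm_num, fun k n c α hα _ hc Q hQ => ?_⟩
  rcases Nat.eq_zero_or_pos n with rfl | hn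
  · obtain ⟨τ, hτ, hR⟩ := SimEmbed.exists_layout_by_color hQ
    obtain ⟨D, hD, hb⟩ := SimEmbed.exists_simultaneousDrawing τ hτ hR
    exact ⟨D, hD, fun i => ⟨(hb i).1, fun e => e.elim0⟩⟩
  have hn' : (1 : ℝ) ≤ n := by exact_mod_cast hn
  rcases le_total ((n : ℝ) ^ α) ((n : ℝ) ^ (1 - (1 / 2 : ℝ) ^ k)) with hle | hle
  · obtain ⟨τ, hτ, hR⟩ := SimEmbed.exists_layout_by_color hQ
    obtain ⟨D, hD, hb⟩ := SimEmbed.exists_simultaneousDrawing τ hτ hR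
    refine ⟨D, hD, fun i => ⟨(hb i).1, fun e => ?_⟩⟩
    have h1 : (((D i).edge e).bends : ℝ) ≤ 4 * c + 4 := by exact_mod_cast (hb i).2 e
    have h2 : 1 ≤ (n : ℝ) ^ α := Real.one_le_rpow hn' hα
    rw [min_eq_left hle]
    linarith
  · obtain ⟨s, m, hs, hsm, hR'⟩ := SimEmbed.exists_grid_size hn k
    obtain ⟨τ, hτ, hR⟩ := SimEmbed.exists_layout_by_cell hQ hs hsm
    obtain ⟨D, hD, hb⟩ := SimEmbed.exists_simultaneousDrawing τ hτ hR
    refine ⟨D, hD, fun i => ⟨(hb i).1, fun e => ?_⟩⟩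
    have h1 : (((D i).edge e).bends : ℝ) ≤ 4 * (m ^ k + s : ℕ) + 4 := by
      exact_mod_cast (hb i).2 e
    have h2 : 1 ≤ (n : ℝ) ^ (1 - (1 / 2 : ℝ) ^ k) :=
      Real.one_le_rpow hn' (sub_nonneg.2 (pow_le_one₀ (by norm_num) (by norm_num)))
    rw [min_eq_right hle]
    linarith
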